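/- **Triangular Decomposition Theorem.** Let $M$ be a compact connected surface, possibly with boundary, with $\chi(M)<0$, and let $\mathbf T$ be a triangular decomposition of $M$, i.e. a finite cell decomposition by triangles that lifts to a triangulation of the universal cover of $M$. Let $F$ be the number of its triangles. Write a vector $x\in\mathbb R^{3F}$ as a family of numbers, one for each of the $3F$ angle slots (corners of triangles). For a triangle $t$ let $d^t(x)=\{A,B,C\}$ be the three entries of $x$ in $t$ and $k^t(x)=A+B+C-\pi$. Let $V\subset\mathbb R^{3F}$ be the affine flat of those $x$ whose entries around each interior vertex sum to $2\pi$ and around each boundary vertex sum to $\pi$. An *angle system* is a point of $$\mathbf N=\{x\in V \mid k^t(x)<0 \text{ for every triangle } t, \text{ and every entry of } x \text{ lies in } (0,\pi)\}.$$ An angle system $u$ is *uniform* if the hyperbolic triangles with angle data $d^t(u)$ fit together along the edges of $\mathbf T$, i.e. any two sides of triangles that are the same edge of $\mathbf T$ have equal hyperbolic length (so that the triangles glue to a hyperbolic structure on $M$). For each interior edge $e$, shared by the triangles $t_1$ and $t_2$, let $w_e\in\mathbb R^{3F}$ be the vector with entry $1$ in the two slots of $t_1$ adjacent to $e$, entry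 $-1$ in the two slots of $t_2$ adjacent to $e$, and $0$ elsewhere (contributions being added if $t_1=t_2$). Let $C$ be the span of all the $w_e$; vectors $x,y$ are *conformally equivalent* if $x-y\in C$. Let $\partial\mathbf N=\overline{\mathbf N}\setminus\mathbf N$ be the boundary of $\mathbf N$ in $V$. For $x\in\partial\mathbf N$ a triangle $t$ is *legal* if $d^t(x)\ne\{0,0,\pi\}$ and either $k^t(x)=0$ or some entry of $d^t(x)$ is $0$. Let $$B=\{x\in\partial\mathbf N\mid \text{no triangle is legal with respect to } x\}.$$ Let $x$ be an angle system. Then: 1. there is at most one uniform angle system conformally equivalent to $x$; 2. if $(x+C)\cap B=\emptyset$, then there exists a uniform angle system conformally equivalent to $x$. -/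

import Mathlib

open scoped Manifold UpperHalfPlane Classical

noncomputable section

/-! ### Triangular decompositions of surfaces -/

/-- The closed triangle, in barycentric coordinates. -/
abbrev Triangle : Type := stdSimplex ℝ (Fin 3)

/-- The closed face of the triangle spanned by the corners in `S` (empty if `S` is empty). -/
def Triangle.face (S : Finset (Fin 3)) : Set Triangle := {x | ∀ i, i ∉ S → x i = 0}

/-- A decomposition of the space `M` into cells whose 2-cells are triangles, indexed by `F`.
The triangle `t` has the characteristic map `cell t`, which may identify boundary points with each
other. The open cells are the images of the open faces of the triangles (the open triangles, their
open sides and their corners): each open face is embedded in `M`, the images of two open faces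
coincide or are disjoint, and in the first case the two closed faces are identified by an affine
map that matches their corners. Distinct triangles have disjoint interiors. -/
structure TriangularDecomposition (F : Type*) (M : Type*) [TopologicalSpace M] where
  cell : F → Triangle → M
  continuous_cell : ∀ t, Continuous (cell t)
  cover : ∀ m : M, ∃ t x, cell t x = m
  open_face_injective : ∀ t (x y : Triangle), (∀ i, x i = 0 ↔ y i = 0) →
    cell t x = cell t y → x = y
  face_identification : ∀ t t' (x x' : Triangle), cell t x = cell t' x' →
    ∃ e : Equiv.Perm (Fin 3), (∀ i, x' (e i) = x i) ∧
      ∀ y y' : Triangle, (∀ i, x i = 0 → y i = 0) → (∀ i, y' (e i) = y i) →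
        cell t y = cell t' y'
  interior_disjoint : ∀ t t' (x x' : Triangle), cell t x = cell t' x' → (∀ i, x i ≠ 0) → t = t'

namespace TriangularDecomposition

variable {F M : Type*} [TopologicalSpace M] (T : TriangularDecomposition F M)

/-- The decomposition lifts to a triangulation along `p : M' → M` (to be used for the universal
cover `p`): every lift of a triangle is embedded in `M'`, and any two lifted triangles intersect
in a common face of both, that is in the empty set, a vertex, an edge with its two vertices, or
(if they coincide) in the whole triangle. -/
def LiftsToTriangulation {M' : Type*} [TopologicalSpace M'] (p : M' → M) : Prop :=
  ∀ (t t' : F) (f g : C(Triangle, M')),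
    (∀ x, p (f x) = T.cell t x) → (∀ x, p (g x) = T.cell t' x) →
      Function.Injective f ∧
      ∃ S S' : Finset (Fin 3),
        Set.range f ∩ Set.range g = f '' Triangle.face S ∧
        Set.range f ∩ Set.range g = g '' Triangle.face S'

/-- The point of `M` at the corner `i` of the triangle `t`. -/
def vertex (t : F) (i : Fin 3) : M := T.cell t (stdSimplex.vertex i)

/-- The edge of the decomposition, as a closed subset of `M`, which is the side of the triangle
`t` opposite to its corner `i`. -/
def edge (t : F) (i : Fin 3) : Set M := T.cell t '' {x | x i = 0}

/-- The set of vertices. -/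
def vertices : Set M := {v | ∃ t i, T.vertex t i = v}

/-- The set of edges. -/
def edges : Set (Set M) := {e | ∃ t i, T.edge t i = e}

/-- The Euler characteristic `V - E + F` of the decomposed surface. -/
def eulerChar : ℤ := (T.vertices.ncard : ℤ) - (T.edges.ncard : ℤ) + (Nat.card F : ℤ)

/-! ### Angle systems

A vector of `ℝ^{3F}` is a function `x : F → Fin 3 → ℝ`; `x t i` is the entry in the angle slot at
the corner `i` of the triangle `t`. -/

/-- The covector `p^v`: the sum of the entries in all angle slots at the vertex `v`. A triangle
with several corners at `v` contributes once for each of them. -/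
def angleSum [Fintype F] (v : M) (x : F → Fin 3 → ℝ) : ℝ :=
  ∑ t, ∑ i, if T.vertex t i = v then x t i else 0

/-- The affine flat `V`: the entries at an interior vertex of the surface sum to `2π`, those at a
boundary vertex to `π`. -/
def flat [Fintype F] [ChartedSpace (EuclideanHalfSpace 2) M] : Set (F → Fin 3 → ℝ) :=
  {x | ∀ v ∈ T.vertices,
    T.angleSum v x = if v ∈ (𝓡∂ 2).boundary M then Real.pi else 2 * Real.pi}

end TriangularDecomposition

/-- The curvature `k^t(x)`: the sum of the three entries in the triangle `t`, minus `π`. -/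
def triangleCurvature {F : Type*} (x : F → Fin 3 → ℝ) (t : F) : ℝ := (∑ i, x t i) - Real.pi

/-- The triangle `t` is legal with respect to `x`: its angle data are not `{0, 0, π}`, but its
curvature is zero or one of its angles is zero. -/
def IsLegal {F : Type*} (x : F → Fin 3 → ℝ) (t : F) : Prop :=
  (¬ ∃ i, x t i = Real.pi ∧ ∀ j, j ≠ i → x t j = 0) ∧
    (triangleCurvature x t = 0 ∨ ∃ i, x t i = 0)

/-! ### Hyperbolic triangles -/

/-- The image of `w` under the isometry from the upper half plane to the Poincaré disc that sends
`z` to the centre. Since geodesics through the centre of the disc are straight and the model is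
conformal, this vector gives the direction at `z` of the geodesic from `z` to `w`. -/
def hypDirection (z w : ℍ) : ℂ := ((w : ℂ) - z) / ((w : ℂ) - (starRingEnd ℂ) (z : ℂ))

/-- The angle at `z` between the geodesics from `z` to `w` and from `z` to `w'`. -/
def hypAngle (w z w' : ℍ) : ℝ := InnerProductGeometry.angle (hypDirection z w) (hypDirection z w')

/-- `P 0`, `P 1`, `P 2` are the vertices of a hyperbolic triangle whose interior angles are
`A 0`, `A 1`, `A 2`. -/
def IsHyperbolicTriangle (P : Fin 3 → ℍ) (A : Fin 3 → ℝ) : Prop :=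
  Function.Injective P ∧ ∀ i, hypAngle (P (i + 1)) (P i) (P (i + 2)) = A i

/-- The length of the side opposite to the vertex `i`. -/
def oppositeSideLength (P : Fin 3 → ℍ) (i : Fin 3) : ℝ := dist (P (i + 1)) (P (i + 2))

namespace TriangularDecomposition

variable {F M : Type*} [TopologicalSpace M] (T : TriangularDecomposition F M)

/-- The set `N` of angle systems. -/
def angleSystems [Fintype F] [ChartedSpace (EuclideanHalfSpace 2) M] : Set (F → Fin 3 → ℝ) :=
  {x | x ∈ T.flat ∧ ∀ t, triangleCurvature x t < 0 ∧ ∀ i, 0 < x t i ∧ x t i < Real.pi}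

/-- The boundary of `N`. Since `N` is a relatively open subset of the closed set `V`, its boundary
in `V` consists of the points of its closure that are not in `N`. -/
def angleBoundary [Fintype F] [ChartedSpace (EuclideanHalfSpace 2) M] : Set (F → Fin 3 → ℝ) :=
  closure T.angleSystems \ T.angleSystems

/-- The bad set `B`: the boundary points of `N` without any legal triangle. -/
def badSet [Fintype F] [ChartedSpace (EuclideanHalfSpace 2) M] : Set (F → Fin 3 → ℝ) :=
  {x | x ∈ T.angleBoundary ∧ ∀ t, ¬ IsLegal x t}

/-- An angle system `u` is uniform if the hyperbolic triangles with the angles prescribed by `u`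
fit together along the edges of the decomposition: any two sides of triangles that are the same
edge have the same length. -/
def IsUniform [Fintype F] [ChartedSpace (EuclideanHalfSpace 2) M] (u : F → Fin 3 → ℝ) : Prop :=
  u ∈ T.angleSystems ∧
    ∃ P : F → Fin 3 → ℍ, (∀ t, IsHyperbolicTriangle (P t) (u t)) ∧
      ∀ t i t' i', T.edge t i = T.edge t' i' →
        oppositeSideLength (P t) i = oppositeSideLength (P t') i'

/-- The vector with entry `1` in the two slots of the triangle `t` adjacent to the side opposite
to the corner `i`, and entry `0` in all other slots. -/
def sideVector (t : F) (i : Fin 3) : F → Fin 3 → ℝ :=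
  fun t' j => if t' = t ∧ j ≠ i then 1 else 0

/-- The space `C` of conformal deformations, spanned by the vectors `w_e` of the interior edges
`e`. An edge is interior if it is a side of triangles in two ways, as the side of `t₁` opposite to
the corner `i₁` and as the side of `t₂` opposite to the corner `i₂`. Then `w_e` has the entry `1`
in the two slots of `t₁` adjacent to `e` and `-1` in those of `t₂`; the contributions are added if
`t₁ = t₂`. (The choice of the order only changes the sign.) -/
def conformalDeformations : Submodule ℝ (F → Fin 3 → ℝ) :=
  Submodule.span ℝ {w | ∃ t₁ i₁ t₂ i₂, (t₁, i₁) ≠ (t₂, i₂) ∧ T.edge t₁ i₁ = T.edge t₂ i₂ ∧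
    w = sideVector t₁ i₁ - sideVector t₂ i₂}

/-- `x` and `y` are conformally equivalent. -/
def ConformallyEquivalent (x y : F → Fin 3 → ℝ) : Prop := x - y ∈ T.conformalDeformations

end TriangularDecomposition

end

/-! ### Trigonometry of hyperbolic triangles -/

/-! Uniform angle systems are the critical points, on a conformal class, of a total volume that is
strictly concave there. By the dual law of cosines the angles of a triangle determine its side
lengths `l i`, with `cosh (l i) = sideCosh a i`. The function `prismVolume` has derivative `∑ i,
sideCoord d i * log ((sideCosh a i - 1) / 2)` in the direction `d` (`prismRate_eq`). Such a pairing,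
summed over the triangles, vanishes on all conformal deformations exactly when the logarithms agree
on sides that are the same edge, that is, when lengths match.

Uniqueness: along the segment joining two equivalent uniform systems the pairing of its direction
with `log (sideCosh - 1)` vanishes at both ends. Its derivative is minus a positive definite form
(`sideForm_pos`, `sideRate_neg`), so the direction must be zero. Only this first derivative is
needed, not the volume itself.

Existence: the closure of the angle systems is compact, so the volume has a maximum on the closed
conformal class. From a boundary point towards an angle system, the derivative of the volume is `-κ
log s` plus a bounded term, where `κ` is a sum of terms `prismOrder ≥ 0`, positive at a legal
triangle (`prismOrder_pos`). So a boundary maximum would have no legal triangle and lie in `B`; if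
the class avoids `B`, the maximum is an interior critical point. -/

theorem UpperHalfPlane.sinh_dist_eq (z w : ℍ) :
    Real.sinh (dist z w) =
      ‖(w : ℂ) - z‖ * ‖(w : ℂ) - (starRingEnd ℂ) (z : ℂ)‖ / (2 * z.im * w.im) := by
  have hz := z.im_pos
  have hw := w.im_pos
  have h : dist z w = 2 * (dist z w / 2) := by ring
  rw [h, Real.sinh_two_mul, UpperHalfPlane.sinh_half_dist, UpperHalfPlane.dist_comm,
    UpperHalfPlane.cosh_half_dist, dist_comm, Complex.dist_eq, Complex.dist_eq]
  have hs := Real.mul_self_sqrt (mul_pos hz hw).le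
  have hp := Real.sqrt_pos.mpr (mul_pos hz hw)
  rw [mul_comm w.im z.im]
  generalize √(z.im * w.im) = q at hs hp
  rw [mul_assoc 2 z.im w.im, ← hs]
  field_simp

/-- The hyperbolic law of cosines. -/
theorem cosh_dist_eq_of_hypAngle (w z w' : ℍ) :
    Real.cosh (dist w w') = Real.cosh (dist z w) * Real.cosh (dist z w') -
      Real.sinh (dist z w) * Real.sinh (dist z w') * Real.cos (hypAngle w z w') := by
  have hz := z.im_pos
  have hw := w.im_pos
  have hw' := w'.im_pos
  -- The numerators of the two `sinh` factors absorb the norms in the cosine of the angle, leaving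
  -- an inner product that is rational in the coordinates.
  have key : ‖(w : ℂ) - z‖ * ‖(w : ℂ) - (starRingEnd ℂ) (z : ℂ)‖ *
      (‖(w' : ℂ) - z‖ * ‖(w' : ℂ) - (starRingEnd ℂ) (z : ℂ)‖) * Real.cos (hypAngle w z w') =
      ‖(w : ℂ) - (starRingEnd ℂ) (z : ℂ)‖ ^ 2 * ‖(w' : ℂ) - (starRingEnd ℂ) (z : ℂ)‖ ^ 2 *
        inner ℝ (hypDirection z w) (hypDirection z w') := by
    rw [hypAngle, ← InnerProductGeometry.cos_angle_mul_norm_mul_norm]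
    have h1 : ∀ v : ℍ, ‖(v : ℂ) - z‖ =
        ‖hypDirection z v‖ * ‖(v : ℂ) - (starRingEnd ℂ) (z : ℂ)‖ := by
      intro v
      have hne : (v : ℂ) - (starRingEnd ℂ) (z : ℂ) ≠ 0 := by
        intro h
        have := congrArg Complex.im h
        simp at this
        linarith [v.im_pos]
      rw [hypDirection, norm_div, div_mul_cancel₀ _ (norm_ne_zero_iff.mpr hne)]
    rw [h1 w, h1 w']
    ring
  have hin : ‖(w : ℂ) - (starRingEnd ℂ) (z : ℂ)‖ ^ 2 *
      ‖(w' : ℂ) - (starRingEnd ℂ) (z : ℂ)‖ ^ 2 *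
        inner ℝ (hypDirection z w) (hypDirection z w') =
      ((w.re - z.re) ^ 2 + w.im ^ 2 - z.im ^ 2) * ((w'.re - z.re) ^ 2 + w'.im ^ 2 - z.im ^ 2) +
      4 * z.im ^ 2 * (w.re - z.re) * (w'.re - z.re) := by
    have h1 : ∀ v : ℍ, 0 < (v.re - z.re) ^ 2 + (v.im + z.im) ^ 2 := fun v => by
      have := v.im_pos
      positivity
    have h2 : ∀ v : ℍ, Complex.normSq ((v : ℂ) - (starRingEnd ℂ) (z : ℂ)) =
        (v.re - z.re) ^ 2 + (v.im + z.im) ^ 2 := fun v => by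
      simp [Complex.normSq_apply]
      ring
    simp only [← Complex.normSq_eq_norm_sq, Complex.inner, hypDirection, Complex.mul_re,
      Complex.conj_re, Complex.conj_im, Complex.div_re, Complex.div_im, h2]
    simp
    have := h1 w
    have := h1 w'
    field_simp
    ring
  have hd : ∀ u v : ℍ, Real.cosh (dist u v) =
      1 + ((u.re - v.re) ^ 2 + (u.im - v.im) ^ 2) / (2 * u.im * v.im) := by
    intro u v
    rw [UpperHalfPlane.cosh_dist, Complex.dist_eq, ← Complex.normSq_eq_norm_sq,
      Complex.normSq_apply]
    simp
    ring
  have hs : Real.sinh (dist z w) * Real.sinh (dist z w') * Real.cos (hypAngle w z w') =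
      (((w.re - z.re) ^ 2 + w.im ^ 2 - z.im ^ 2) * ((w'.re - z.re) ^ 2 + w'.im ^ 2 - z.im ^ 2) +
      4 * z.im ^ 2 * (w.re - z.re) * (w'.re - z.re)) / (4 * z.im ^ 2 * w.im * w'.im) := by
    rw [← hin, ← key, UpperHalfPlane.sinh_dist_eq, UpperHalfPlane.sinh_dist_eq]
    field_simp
    ring
  rw [hs, hd, hd, hd]
  field_simp
  ring

/-- The dual law of cosines, as a consequence of the law of cosines at the three corners. -/
theorem dual_cosine_rule {x y z sx sy sz A B C : ℝ} (hsx : 0 < sx) (hsy : 0 < sy) (hsz : 0 < sz)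
    (hx : sx ^ 2 = x ^ 2 - 1) (hy : sy ^ 2 = y ^ 2 - 1) (hz : sz ^ 2 = z ^ 2 - 1)
    (hA : 0 < Real.sin A) (hB : 0 < Real.sin B)
    (h1 : x = y * z - sy * sz * Real.cos A) (h2 : y = z * x - sz * sx * Real.cos B)
    (h3 : z = x * y - sx * sy * Real.cos C) :
    z * (Real.sin A * Real.sin B) = Real.cos C + Real.cos A * Real.cos B := by
  have e1 : sy * sz * Real.cos A = y * z - x := by linarith
  have e2 : sz * sx * Real.cos B = z * x - y := by linarith
  have e3 : sx * sy * Real.cos C = x * y - z := by linarith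
  -- The right side is symmetric in the three sides; comparing it for two corners gives the law of
  -- sines.
  have qA : (Real.sin A * (sy * sz)) ^ 2 = 1 + 2 * x * y * z - x ^ 2 - y ^ 2 - z ^ 2 := by
    rw [mul_pow, Real.sin_sq, sub_mul, one_mul, ← mul_pow, mul_comm (Real.cos A), e1, mul_pow,
      hy, hz]
    ring
  have qB : (Real.sin B * (sz * sx)) ^ 2 = 1 + 2 * x * y * z - x ^ 2 - y ^ 2 - z ^ 2 := by
    rw [mul_pow, Real.sin_sq, sub_mul, one_mul, ← mul_pow, mul_comm (Real.cos B), e2, mul_pow,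
      hx, hz]
    ring
  have hAB : Real.sin A * (sy * sz) = Real.sin B * (sz * sx) :=
    (sq_eq_sq₀ (by positivity) (by positivity)).mp (qA.trans qB.symm)
  have hne : sx * sy * sz ^ 2 ≠ 0 := by positivity
  apply mul_right_cancel₀ hne
  have l : z * (Real.sin A * Real.sin B) * (sx * sy * sz ^ 2) =
      z * (1 + 2 * x * y * z - x ^ 2 - y ^ 2 - z ^ 2) := by
    rw [← qA]
    linear_combination (-(z * Real.sin A * (sy * sz))) * hAB
  have r : (Real.cos C + Real.cos A * Real.cos B) * (sx * sy * sz ^ 2) =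
      (x * y - z) * (z ^ 2 - 1) + (y * z - x) * (z * x - y) := by
    rw [← e1, ← e2, ← e3, ← hz]
    ring
  rw [l, r]
  ring

/-- The hyperbolic cosine of the side opposite to the corner `i` in a hyperbolic triangle with
angles `a`. -/
noncomputable def sideCosh (a : Fin 3 → ℝ) (i : Fin 3) : ℝ :=
  (Real.cos (a i) + Real.cos (a (i + 1)) * Real.cos (a (i + 2))) /
    (Real.sin (a (i + 1)) * Real.sin (a (i + 2)))

/-- The angle data of hyperbolic triangles. -/
def IsAngleData (a : Fin 3 → ℝ) : Prop := (∀ i, 0 < a i) ∧ ∑ i, a i < Real.pi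

namespace IsAngleData

variable {a : Fin 3 → ℝ}

theorem sum_cyclic (a : Fin 3 → ℝ) (i : Fin 3) : ∑ j, a j = a i + a (i + 1) + a (i + 2) := by
  fin_cases i <;> simp [Fin.sum_univ_three] <;> ring

theorem lt_pi (ha : IsAngleData a) (i : Fin 3) : a i < Real.pi := by
  have h := ha.2
  rw [sum_cyclic a i] at h
  linarith [ha.1 (i + 1), ha.1 (i + 2)]

theorem sin_pos (ha : IsAngleData a) (i : Fin 3) : 0 < Real.sin (a i) :=
  Real.sin_pos_of_pos_of_lt_pi (ha.1 i) (ha.lt_pi i)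

/-- The angle sum condition says `a i < π - (a (i + 1) + a (i + 2))`, and the cosine is decreasing
on `[0, π]`. -/
theorem one_lt_sideCosh (ha : IsAngleData a) (i : Fin 3) : 1 < sideCosh a i := by
  have h := ha.2
  rw [sum_cyclic a i] at h
  have := ha.1 i
  have := ha.1 (i + 1)
  have := ha.1 (i + 2)
  rw [sideCosh, one_lt_div (mul_pos (ha.sin_pos _) (ha.sin_pos _))]
  have h1 : Real.cos (Real.pi - (a (i + 1) + a (i + 2))) < Real.cos (a i) :=
    Real.cos_lt_cos_of_nonneg_of_le_pi (by linarith) (by linarith) (by linarith)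
  rw [Real.cos_pi_sub, Real.cos_add] at h1
  linarith

end IsAngleData

theorem IsHyperbolicTriangle.cosh_oppositeSideLength {P : Fin 3 → ℍ} {a : Fin 3 → ℝ}
    (h : IsHyperbolicTriangle P a) (ha : IsAngleData a) (i : Fin 3) :
    Real.cosh (oppositeSideLength P i) = sideCosh a i := by
  have hpos : ∀ i j, i ≠ j → 0 < Real.sinh (dist (P i) (P j)) := fun i j hij =>
    Real.sinh_pos_iff.mpr (dist_pos.mpr (h.1.ne hij))
  have hne1 : ∀ i : Fin 3, i + 1 ≠ i + 2 := by decide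
  have hne2 : ∀ i : Fin 3, i + 2 ≠ i := by decide
  have hne3 : ∀ i : Fin 3, i ≠ i + 1 := by decide
  have a1 : i + 1 + 1 = i + 2 := by revert i; decide
  have a2 : i + 1 + 2 = i := by revert i; decide
  have a3 : i + 2 + 1 = i := by revert i; decide
  have a4 : i + 2 + 2 = i + 1 := by revert i; decide
  have law := fun j => cosh_dist_eq_of_hypAngle (P (j + 1)) (P j) (P (j + 2))
  simp only [h.2] at law
  have l0 := law i
  have l1 := law (i + 1)
  have l2 := law (i + 2)
  rw [a1, a2] at l1
  rw [a3, a4] at l2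
  rw [sideCosh, eq_div_iff (mul_pos (ha.sin_pos _) (ha.sin_pos _)).ne', oppositeSideLength]
  refine dual_cosine_rule (hpos (i + 2) i (hne2 i)) (hpos i (i + 1) (hne3 i))
    (hpos _ _ (hne1 i)) (Real.sinh_sq _) (Real.sinh_sq _) (Real.sinh_sq _)
    (ha.sin_pos _) (ha.sin_pos _) ?_ ?_ ?_
  · rw [l1, dist_comm (P i) (P (i + 1))]
    ring
  · rw [l2, dist_comm (P (i + 2)) (P (i + 1))]
    ring
  · rw [l0, dist_comm (P (i + 2)) (P i)]
    ring

/-! ### Construction of a hyperbolic triangle from its angles -/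

/-- Polar coordinates around `I`: a point at distance `l` with `cosh l = X` has radius `tanh (l / 2)
= √((X - 1) / (X + 1))` in the disc, and the inverse Cayley transform `d ↦ I * (1 + d) / (1 - d)`
carries it to the half plane. -/
theorem exists_hypDirection_eq (X θ : ℝ) (hX : 1 < X) :
    ∃ w : ℍ, hypDirection UpperHalfPlane.I w =
        √((X - 1) / (X + 1)) * (Real.cos θ + Real.sin θ * Complex.I) ∧
      Real.cosh (dist UpperHalfPlane.I w) = X := by
  set t := √((X - 1) / (X + 1)) with ht
  have ht2 : t ^ 2 = (X - 1) / (X + 1) :=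
    Real.sq_sqrt (div_nonneg (by linarith) (by linarith))
  set d : ℂ := t * (Real.cos θ + Real.sin θ * Complex.I) with hd
  have hdsq : Complex.normSq d = (X - 1) / (X + 1) := by
    rw [← ht2, hd, Complex.normSq_mul, Complex.normSq_ofReal, Complex.normSq_add_mul_I,
      Real.cos_sq_add_sin_sq]
    ring
  have hlt : Complex.normSq d < 1 := by
    rw [hdsq, div_lt_one (by linarith)]
    linarith
  have hne : 1 - d ≠ 0 := by
    intro h
    have : d = 1 := by linear_combination -h
    rw [this] at hlt
    simp at hlt
  have hn : 0 < Complex.normSq (1 - d) := Complex.normSq_pos.mpr hne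
  have him : (Complex.I * (1 + d) / (1 - d)).im =
      (1 - Complex.normSq d) / Complex.normSq (1 - d) := by
    rw [Complex.div_im, ← sub_div]
    congr 1
    simp [Complex.normSq_apply]
    ring
  have him' : 0 < (Complex.I * (1 + d) / (1 - d)).im := by
    rw [him]
    exact div_pos (by linarith) hn
  refine ⟨⟨Complex.I * (1 + d) / (1 - d), him'⟩, ?_, ?_⟩
  · rw [hypDirection, UpperHalfPlane.coe_I, Complex.conj_I]
    have h1 : Complex.I * (1 + d) / (1 - d) - Complex.I = 2 * Complex.I * d / (1 - d) := by
      field_simp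
      ring
    have h2 : Complex.I * (1 + d) / (1 - d) - -Complex.I = 2 * Complex.I / (1 - d) := by
      field_simp
      ring
    change (Complex.I * (1 + d) / (1 - d) - Complex.I) /
      (Complex.I * (1 + d) / (1 - d) - -Complex.I) = d
    rw [h1, h2]
    have := Complex.I_ne_zero
    field_simp
  · rw [UpperHalfPlane.cosh_dist, UpperHalfPlane.coe_I, Complex.dist_eq,
      ← Complex.normSq_eq_norm_sq]
    change 1 + Complex.normSq (Complex.I - Complex.I * (1 + d) / (1 - d)) /
      (2 * UpperHalfPlane.I.im * (Complex.I * (1 + d) / (1 - d)).im) = X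
    have h1 : Complex.I - Complex.I * (1 + d) / (1 - d) = -2 * Complex.I * d / (1 - d) := by
      field_simp
      ring
    rw [h1, him, UpperHalfPlane.I_im, Complex.normSq_div, Complex.normSq_mul, hdsq]
    have h2 : Complex.normSq (-2 * Complex.I) = 4 := by
      simp [Complex.normSq_apply]
      norm_num
    have h3 : X + 1 ≠ 0 := by linarith
    have h4 : 1 - (X - 1) / (X + 1) = 2 / (X + 1) := by
      field_simp
      ring
    rw [h2, h4]
    field_simp
    ring

theorem cos_hypAngle_of_hypDirection {w z w' : ℍ} {r r' θ : ℝ} (hr : 0 < r) (hr' : 0 < r')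
    (h : hypDirection z w = r * (Real.cos 0 + Real.sin 0 * Complex.I))
    (h' : hypDirection z w' = r' * (Real.cos θ + Real.sin θ * Complex.I)) :
    Real.cos (hypAngle w z w') = Real.cos θ := by
  have hn : ‖((Real.cos θ : ℝ) : ℂ) + (Real.sin θ : ℝ) * Complex.I‖ = 1 := by
    rw [Complex.ofReal_cos, Complex.ofReal_sin, Complex.norm_cos_add_sin_mul_I]
  rw [hypAngle, InnerProductGeometry.cos_angle, h, h', norm_mul, norm_mul, hn, Complex.inner]
  simp [abs_of_pos hr, abs_of_pos hr']
  field_simp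
  simp [← Complex.ofReal_cos]

/-- The expression `4 cos(S/2) ∏ cos(S/2 - aᵢ)`, with `S` the sum of the angles. -/
noncomputable def angleDisc (a : Fin 3 → ℝ) (i : Fin 3) : ℝ :=
  (Real.cos (a i) + Real.cos (a (i + 1)) * Real.cos (a (i + 2))) ^ 2 -
    (Real.sin (a (i + 1)) * Real.sin (a (i + 2))) ^ 2

/-- The expanded form is symmetric in the angles, so `angleDisc a i` does not depend on `i`. -/
theorem angleDisc_eq (a : Fin 3 → ℝ) (i : Fin 3) :
    angleDisc a i = Real.cos (a i) ^ 2 + Real.cos (a (i + 1)) ^ 2 + Real.cos (a (i + 2)) ^ 2 +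
      2 * Real.cos (a i) * Real.cos (a (i + 1)) * Real.cos (a (i + 2)) - 1 := by
  rw [angleDisc, mul_pow (Real.sin _), Real.sin_sq, Real.sin_sq]
  ring

theorem IsAngleData.angleDisc_pos {a : Fin 3 → ℝ} (ha : IsAngleData a) (i : Fin 3) :
    0 < angleDisc a i := by
  have h := ha.one_lt_sideCosh i
  have hs := mul_pos (ha.sin_pos (i + 1)) (ha.sin_pos (i + 2))
  rw [sideCosh, one_lt_div hs] at h
  rw [angleDisc, sub_pos]
  exact pow_lt_pow_left₀ h hs.le two_ne_zero

/-- This is the hyperbolic sine of the prospective side. Its numerator is common to the three sides,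
which is the law of sines. -/
theorem IsAngleData.sqrt_sideCosh_sq_sub_one {a : Fin 3 → ℝ} (ha : IsAngleData a) (i : Fin 3) :
    √(sideCosh a i ^ 2 - 1) =
      √(angleDisc a i) / (Real.sin (a (i + 1)) * Real.sin (a (i + 2))) := by
  have hs := mul_pos (ha.sin_pos (i + 1)) (ha.sin_pos (i + 2))
  rw [← Real.sqrt_sq hs.le, ← Real.sqrt_div (ha.angleDisc_pos i).le]
  congr 1
  rw [sideCosh, angleDisc, div_pow, sub_div, div_self (pow_ne_zero 2 hs.ne')]

/-- The law of cosines for lengths defined from the angles alone, before any triangle is known to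
exist; it is what lets the construction below close up. -/
theorem IsAngleData.sideCosh_cosine_rule {a : Fin 3 → ℝ} (ha : IsAngleData a) (i : Fin 3) :
    sideCosh a i = sideCosh a (i + 1) * sideCosh a (i + 2) -
      √(sideCosh a (i + 1) ^ 2 - 1) * √(sideCosh a (i + 2) ^ 2 - 1) * Real.cos (a i) := by
  have a1 : i + 1 + 1 = i + 2 := by revert i; decide
  have a2 : i + 1 + 2 = i := by revert i; decide
  have a3 : i + 2 + 1 = i := by revert i; decide
  have a4 : i + 2 + 2 = i + 1 := by revert i; decide
  have d1 : angleDisc a (i + 1) = angleDisc a i := by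
    rw [angleDisc_eq, angleDisc_eq, a1, a2]
    ring
  have d2 : angleDisc a (i + 2) = angleDisc a i := by
    rw [angleDisc_eq, angleDisc_eq, a3, a4]
    ring
  rw [ha.sqrt_sideCosh_sq_sub_one, ha.sqrt_sideCosh_sq_sub_one, d1, d2, div_mul_div_comm,
    Real.mul_self_sqrt (ha.angleDisc_pos i).le, angleDisc_eq, sideCosh, sideCosh, sideCosh,
    a1, a2, a3, a4]
  have h0 := (ha.sin_pos i).ne'
  have h1 := (ha.sin_pos (i + 1)).ne'
  have h2 := (ha.sin_pos (i + 2)).ne'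
  have q0 := Real.sin_sq (a i)
  field_simp
  rw [q0]
  ring

/-- There is a hyperbolic triangle with given angles whose sum is less than `π`. -/
theorem IsAngleData.exists_isHyperbolicTriangle {a : Fin 3 → ℝ} (ha : IsAngleData a) :
    ∃ P : Fin 3 → ℍ, IsHyperbolicTriangle P a := by
  have hsh : ∀ z w : ℍ, Real.sinh (dist z w) = √(Real.cosh (dist z w) ^ 2 - 1) := fun z w => by
    rw [← Real.sinh_sq, Real.sqrt_sq (Real.sinh_nonneg_iff.mpr dist_nonneg)]
  have X0 := ha.one_lt_sideCosh 0
  have X1 := ha.one_lt_sideCosh 1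
  have X2 := ha.one_lt_sideCosh 2
  -- Two sides and the included angle: corner 0 at `I`, the other two at the prescribed distances in
  -- the directions `0` and `a 0`. The cosine rule then gives the third side and the remaining
  -- angles.
  obtain ⟨w, hw, hcw⟩ := exists_hypDirection_eq (sideCosh a 2) 0 X2
  obtain ⟨w', hw', hcw'⟩ := exists_hypDirection_eq (sideCosh a 1) (a 0) X1
  have hang := cos_hypAngle_of_hypDirection
    (Real.sqrt_pos.mpr (div_pos (by linarith) (by linarith)))
    (Real.sqrt_pos.mpr (div_pos (by linarith) (by linarith))) hw hw'
  have r0 : sideCosh a 0 = sideCosh a 1 * sideCosh a 2 - _ := ha.sideCosh_cosine_rule 0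
  have r1 : sideCosh a 1 = sideCosh a 2 * sideCosh a 0 - _ := ha.sideCosh_cosine_rule 1
  have r2 : sideCosh a 2 = sideCosh a 0 * sideCosh a 1 - _ := ha.sideCosh_cosine_rule 2
  have hc0 : Real.cosh (dist w w') = sideCosh a 0 := by
    have := cosh_dist_eq_of_hypAngle w UpperHalfPlane.I w'
    rw [hsh, hsh, hcw, hcw', hang] at this
    rw [this, r0]
    change _ = _ - √(sideCosh a 1 ^ 2 - 1) * √(sideCosh a 2 ^ 2 - 1) * Real.cos (a 0)
    ring
  have hs : ∀ {X : ℝ}, 1 < X → √(X ^ 2 - 1) ≠ 0 := fun {X} hX =>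
    (Real.sqrt_pos.mpr (by nlinarith)).ne'
  have hang1 : Real.cos (hypAngle w' w UpperHalfPlane.I) = Real.cos (a 1) := by
    have := cosh_dist_eq_of_hypAngle w' w UpperHalfPlane.I
    rw [hsh, hsh, dist_comm w', dist_comm w UpperHalfPlane.I, hcw, hc0, hcw', r1] at this
    change _ - √(sideCosh a 2 ^ 2 - 1) * √(sideCosh a 0 ^ 2 - 1) * Real.cos (a 1) = _ at this
    apply mul_left_cancel₀ (mul_ne_zero (hs X2) (hs X0))
    linarith
  have hang2 : Real.cos (hypAngle UpperHalfPlane.I w' w) = Real.cos (a 2) := by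
    have := cosh_dist_eq_of_hypAngle UpperHalfPlane.I w' w
    rw [hsh, hsh, dist_comm w' UpperHalfPlane.I, dist_comm w', hcw, hc0, hcw', r2] at this
    change _ - √(sideCosh a 0 ^ 2 - 1) * √(sideCosh a 1 ^ 2 - 1) * Real.cos (a 2) = _ at this
    apply mul_left_cancel₀ (mul_ne_zero (hs X0) (hs X1))
    linarith
  have hne : ∀ {u v : ℍ} {i : Fin 3}, Real.cosh (dist u v) = sideCosh a i → u ≠ v := by
    rintro u _ i h rfl
    rw [dist_self, Real.cosh_zero] at h
    linarith [ha.one_lt_sideCosh i]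
  have n1 := hne hcw
  have n2 := hne hcw'
  have n3 := hne hc0
  have hinj : ∀ {u v z : ℍ} {i : Fin 3}, Real.cos (hypAngle u v z) = Real.cos (a i) →
      hypAngle u v z = a i := fun {u v z i} h =>
    Real.injOn_cos ⟨InnerProductGeometry.angle_nonneg _ _, InnerProductGeometry.angle_le_pi _ _⟩
      ⟨(ha.1 i).le, (ha.lt_pi i).le⟩ h
  refine ⟨![UpperHalfPlane.I, w, w'], ?_, ?_⟩
  · intro i j hij
    fin_cases i <;> fin_cases j <;> first | rfl | (simp at hij; tauto)
  · intro i
    fin_cases i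
    · exact hinj hang
    · exact hinj hang1
    · exact hinj hang2

/-! ### Uniformity as a condition on the angles -/

theorem TriangularDecomposition.isAngleData {F M : Type*} [TopologicalSpace M] [Fintype F]
    [ChartedSpace (EuclideanHalfSpace 2) M] {T : TriangularDecomposition F M}
    {u : F → Fin 3 → ℝ} (hu : u ∈ T.angleSystems) (t : F) : IsAngleData (u t) :=
  ⟨fun i => ((hu.2 t).2 i).1, sub_neg.mp (hu.2 t).1⟩

/-- An angle system is uniform if and only if the side lengths computed from the angles match. -/
theorem TriangularDecomposition.isUniform_iff {F M : Type*} [TopologicalSpace M] [Fintype F]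
    [ChartedSpace (EuclideanHalfSpace 2) M] (T : TriangularDecomposition F M)
    (u : F → Fin 3 → ℝ) : T.IsUniform u ↔ u ∈ T.angleSystems ∧
      ∀ t i t' i', T.edge t i = T.edge t' i' → sideCosh (u t) i = sideCosh (u t') i' := by
  refine and_congr_right fun hu => ⟨?_, fun h => ?_⟩
  · rintro ⟨P, hP, h⟩ t i t' i' he
    rw [← (hP t).cosh_oppositeSideLength (isAngleData hu t),
      ← (hP t').cosh_oppositeSideLength (isAngleData hu t'), h t i t' i' he]
  · choose P hP using fun t => (isAngleData hu t).exists_isHyperbolicTriangle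
    refine ⟨P, hP, fun t i t' i' he => ?_⟩
    refine Real.cosh_strictMonoOn.injOn dist_nonneg dist_nonneg ?_
    have := h t i t' i' he
    rwa [← (hP t).cosh_oppositeSideLength (isAngleData hu t),
      ← (hP t').cosh_oppositeSideLength (isAngleData hu t')] at this

/-! ### Conformal deformations -/

/-- The coordinates of the angle data `d` of a triangle with respect to the vectors that have the
entry `1` at the two corners adjacent to a side. -/
noncomputable def sideCoord (d : Fin 3 → ℝ) (i : Fin 3) : ℝ := (d (i + 1) + d (i + 2) - d i) / 2

theorem sideCoord_add (d e : Fin 3 → ℝ) (i : Fin 3) :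
    sideCoord (d + e) i = sideCoord d i + sideCoord e i := by
  simp only [sideCoord, Pi.add_apply]
  ring

theorem sideCoord_sub (d e : Fin 3 → ℝ) (i : Fin 3) :
    sideCoord (d - e) i = sideCoord d i - sideCoord e i := by
  simp only [sideCoord, Pi.sub_apply]
  ring

theorem sideCoord_smul (r : ℝ) (d : Fin 3 → ℝ) (i : Fin 3) :
    sideCoord (r • d) i = r * sideCoord d i := by
  simp only [sideCoord, Pi.smul_apply, smul_eq_mul]
  ring

theorem sideCoord_add_sideCoord (d : Fin 3 → ℝ) (i : Fin 3) :
    sideCoord d (i + 1) + sideCoord d (i + 2) = d i := by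
  have a1 : i + 1 + 1 = i + 2 := by revert i; decide
  have a2 : i + 1 + 2 = i := by revert i; decide
  have a3 : i + 2 + 1 = i := by revert i; decide
  have a4 : i + 2 + 2 = i + 1 := by revert i; decide
  simp only [sideCoord, a1, a2, a3, a4]
  ring

namespace TriangularDecomposition

/-- The functionals `sideCoord` are dual to the side vectors, so pairing a side vector with `c`
reads off one value of `c`. -/
theorem sideCoord_sideVector {F : Type*} (t : F) (i : Fin 3) (t' : F) (j : Fin 3) :
    sideCoord (sideVector t i t') j = if t' = t ∧ j = i then 1 else 0 := by
  by_cases h : t' = t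
  · fin_cases i <;> fin_cases j <;> simp [sideCoord, sideVector, h]
  · simp [sideCoord, sideVector, h]

theorem sum_sideCoord_sideVector_mul {F : Type*} [Fintype F] (c : F → Fin 3 → ℝ) (t : F)
    (i : Fin 3) : ∑ t', ∑ j, sideCoord (sideVector t i t') j * c t' j = c t i := by
  simp_rw [sideCoord_sideVector, ite_and, ite_mul, one_mul, zero_mul]
  rw [Finset.sum_eq_single t (fun t' _ h => by simp [h]) (by simp)]
  simp

variable {F M : Type*} [TopologicalSpace M] [Fintype F] (T : TriangularDecomposition F M)

/-- A function on the sides of the triangles that takes the same value on sides that are the same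
edge annihilates the conformal deformations. -/
theorem sum_sideCoord_mul_eq_zero {c : F → Fin 3 → ℝ}
    (hc : ∀ t i t' i', T.edge t i = T.edge t' i' → c t i = c t' i') {d : F → Fin 3 → ℝ}
    (hd : d ∈ T.conformalDeformations) : ∑ t, ∑ i, sideCoord (d t) i * c t i = 0 := by
  induction hd using Submodule.span_induction with
  | mem w hw =>
    obtain ⟨t₁, i₁, t₂, i₂, -, he, rfl⟩ := hw
    simp_rw [Pi.sub_apply, sideCoord_sub, sub_mul, Finset.sum_sub_distrib]
    rw [sum_sideCoord_sideVector_mul, sum_sideCoord_sideVector_mul, hc _ _ _ _ he, sub_self]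
  | zero => simp [sideCoord]
  | add x y _ _ hx hy =>
    simp_rw [Pi.add_apply, sideCoord_add, add_mul, Finset.sum_add_distrib]
    rw [hx, hy, add_zero]
  | smul r x _ hx =>
    simp_rw [Pi.smul_apply, sideCoord_smul, mul_assoc, ← Finset.mul_sum]
    rw [hx, mul_zero]

/-- Converse of `sum_sideCoord_mul_eq_zero`: test on the generator belonging to the edge. -/
theorem eq_of_sum_sideCoord_mul_eq_zero {c : F → Fin 3 → ℝ}
    (h : ∀ d ∈ T.conformalDeformations, ∑ t, ∑ i, sideCoord (d t) i * c t i = 0)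
    {t t' : F} {i i' : Fin 3} (he : T.edge t i = T.edge t' i') : c t i = c t' i' := by
  by_cases hne : (t, i) = (t', i')
  · simp only [Prod.mk.injEq] at hne
    rw [hne.1, hne.2]
  · have := h _ (Submodule.subset_span ⟨t, i, t', i', hne, he, rfl⟩)
    simp_rw [Pi.sub_apply, sideCoord_sub, sub_mul, Finset.sum_sub_distrib] at this
    rw [sum_sideCoord_sideVector_mul, sum_sideCoord_sideVector_mul] at this
    linarith

theorem angleSum_add (v : M) (x y : F → Fin 3 → ℝ) :
    T.angleSum v (x + y) = T.angleSum v x + T.angleSum v y := by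
  simp only [angleSum, ← Finset.sum_add_distrib]
  refine Finset.sum_congr rfl fun t _ => Finset.sum_congr rfl fun i _ => ?_
  split_ifs <;> simp

theorem angleSum_smul (v : M) (r : ℝ) (x : F → Fin 3 → ℝ) :
    T.angleSum v (r • x) = r * T.angleSum v x := by
  simp only [angleSum, Finset.mul_sum]
  refine Finset.sum_congr rfl fun t _ => Finset.sum_congr rfl fun i _ => ?_
  split_ifs <;> simp

theorem angleSum_sub (v : M) (x y : F → Fin 3 → ℝ) :
    T.angleSum v (x - y) = T.angleSum v x - T.angleSum v y := by
  have := T.angleSum_add v (x - y) y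
  rw [sub_add_cancel] at this
  linarith

/-- Sides that are the same edge have the same end points. -/
theorem exists_perm_vertex_eq {F M : Type*} [TopologicalSpace M]
    (T : TriangularDecomposition F M) {t t' : F} {i i' : Fin 3}
    (he : T.edge t i = T.edge t' i') :
    ∃ e : Equiv.Perm (Fin 3), e i = i' ∧ ∀ j, j ≠ i → T.vertex t j = T.vertex t' (e j) := by
  -- The midpoint of the side. Its only zero coordinate is `i`, so the permutation identifying the
  -- faces at this point sends `i` to `i'` and matches both end points.
  let m : Triangle := ⟨fun j => if j = i then 0 else 1 / 2, by
    constructor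
    · intro j
      dsimp only
      split_ifs <;> norm_num
    · fin_cases i <;> simp [Fin.sum_univ_three] <;> norm_num⟩
  have hm : ∀ j, m j = if j = i then 0 else 1 / 2 := fun j => rfl
  have hmem : T.cell t m ∈ T.edge t' i' := he ▸ ⟨m, by simp [hm], rfl⟩
  obtain ⟨m', hm', hcell⟩ := hmem
  obtain ⟨e, he1, he2⟩ := T.face_identification t t' m m' hcell.symm
  have hei : e i = i' := by
    have h1 := he1 (e.symm i')
    rw [Equiv.apply_symm_apply, show m' i' = 0 from hm', hm] at h1
    split_ifs at h1 with h
    · rw [← h, Equiv.apply_symm_apply]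
    · norm_num at h1
  refine ⟨e, hei, fun j hj => he2 _ _ (fun k hk => ?_) fun k => ?_⟩
  · rw [hm] at hk
    split_ifs at hk with h
    · subst h
      simp [stdSimplex.vertex, hj.symm]
    · norm_num at hk
  · simp [stdSimplex.vertex, Pi.single_apply]

theorem angleSum_sideVector (v : M) (t : F) (i : Fin 3) :
    T.angleSum v (sideVector t i) =
      ∑ j, if j ≠ i then (if T.vertex t j = v then 1 else 0) else 0 := by
  rw [angleSum, Finset.sum_eq_single t (fun t' _ h => by simp [sideVector, h]) (by simp)]
  refine Finset.sum_congr rfl fun j _ => ?_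
  simp only [sideVector, true_and]
  split_ifs <;> rfl

/-- At each end point of an edge, its deformation vector contributes `1` from one side and `-1` from
the other. -/
theorem angleSum_eq_zero (v : M) {d : F → Fin 3 → ℝ} (hd : d ∈ T.conformalDeformations) :
    T.angleSum v d = 0 := by
  induction hd using Submodule.span_induction with
  | mem w hw =>
    obtain ⟨t₁, i₁, t₂, i₂, -, he, rfl⟩ := hw
    obtain ⟨e, rfl, h⟩ := T.exists_perm_vertex_eq he
    rw [angleSum_sub, angleSum_sideVector, angleSum_sideVector, sub_eq_zero,
      ← Equiv.sum_comp e (fun j => if j ≠ e i₁ then (if T.vertex t₂ j = v then (1 : ℝ) else 0)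
        else 0)]
    refine Finset.sum_congr rfl fun j _ => ?_
    by_cases hj : j = i₁
    · simp [hj]
    · simp [hj, h j hj]
  | zero => simp [angleSum]
  | add x y _ _ hx hy => rw [angleSum_add, hx, hy, add_zero]
  | smul r x _ hx => rw [angleSum_smul, hx, mul_zero]

theorem mem_flat_of_conformallyEquivalent [ChartedSpace (EuclideanHalfSpace 2) M]
    {x y : F → Fin 3 → ℝ} (hx : x ∈ T.flat) (h : T.ConformallyEquivalent y x) : y ∈ T.flat := by
  intro v hv
  have := T.angleSum_eq_zero v h
  rw [angleSum_sub] at this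
  rw [← hx v hv]
  linarith

end TriangularDecomposition

/-! ### The side lengths along a line of angle data -/

/-- By the cosine rule this Gram-type determinant is `sinh² * sinh² * sin²` for two sides and the
included angle. -/
theorem IsAngleData.gram_pos {a : Fin 3 → ℝ} (ha : IsAngleData a) :
    0 < 1 + 2 * sideCosh a 0 * sideCosh a 1 * sideCosh a 2 -
      sideCosh a 0 ^ 2 - sideCosh a 1 ^ 2 - sideCosh a 2 ^ 2 := by
  have X1 := ha.one_lt_sideCosh 1
  have X2 := ha.one_lt_sideCosh 2
  have h1 : 0 < sideCosh a 1 ^ 2 - 1 := by nlinarith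
  have h2 : 0 < sideCosh a 2 ^ 2 - 1 := by nlinarith
  have r0 : sideCosh a 0 = sideCosh a 1 * sideCosh a 2 -
    √(sideCosh a 1 ^ 2 - 1) * √(sideCosh a 2 ^ 2 - 1) * Real.cos (a 0) :=
    ha.sideCosh_cosine_rule 0
  have e1 := Real.sq_sqrt h1.le
  have e2 := Real.sq_sqrt h2.le
  have hs := ha.sin_pos 0
  have e3 := Real.sin_sq_add_cos_sq (a 0)
  have : 1 + 2 * sideCosh a 0 * sideCosh a 1 * sideCosh a 2 -
      sideCosh a 0 ^ 2 - sideCosh a 1 ^ 2 - sideCosh a 2 ^ 2 =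
      (sideCosh a 1 ^ 2 - 1) * (sideCosh a 2 ^ 2 - 1) * Real.sin (a 0) ^ 2 := by
    rw [Real.sin_sq, mul_sub, ← e1, ← e2, mul_one, ← mul_pow, ← mul_pow,
      show √(sideCosh a 1 ^ 2 - 1) * √(sideCosh a 2 ^ 2 - 1) * Real.cos (a 0) =
        sideCosh a 1 * sideCosh a 2 - sideCosh a 0 by linarith, mul_pow, e1, e2]
    ring
  rw [this]
  positivity

/-- The quadratic form that describes, up to a positive factor, the variation of the side lengths
of a hyperbolic triangle with its angles is positive definite. -/
theorem sideForm_pos {x y z : ℝ} (hx : 1 < x) (hy : 1 < y) (hz : 1 < z)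
    (hg : 0 < 1 + 2 * x * y * z - x ^ 2 - y ^ 2 - z ^ 2) {u v w : ℝ}
    (h : u ≠ 0 ∨ v ≠ 0 ∨ w ≠ 0) :
    0 < (x + 1) * u * ((v + w) + z * (w + u) + y * (u + v)) +
      (y + 1) * v * ((w + u) + x * (u + v) + z * (v + w)) +
      (z + 1) * w * ((u + v) + y * (v + w) + x * (w + u)) := by
  -- Completing the square in `u`, after scaling by `(y + z) * (x + 1)`, leaves `α v² + 2 β v w + γ
  -- w²`; its determinant is a positive multiple of the Gram expression.
  set α := (x + 1) * (y + 1) * ((y + z) * (x + z) - (x + 1) * (y + 1)) with hα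
  set β := (x + 1) * (y + 1) * (z + 1) * (y + z - x - 1) with hβ
  set γ := (x + 1) * (z + 1) * ((y + z) * (x + y) - (x + 1) * (z + 1)) with hγ
  have hα0 : 0 < α := by
    have : (y + z) * (x + z) - (x + 1) * (y + 1) = (z - 1) * (x + y) + (z - 1) * (z + 1) := by ring
    rw [hα, this]
    have : 0 < z - 1 := by linarith
    positivity
  have hdet : α * γ - β ^ 2 = (x + 1) ^ 2 * (y + 1) * (z + 1) * (y + z) *
      (2 * (1 + 2 * x * y * z - x ^ 2 - y ^ 2 - z ^ 2)) := by
    rw [hα, hβ, hγ]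
    ring
  have hdet0 : 0 < α * γ - β ^ 2 := by
    rw [hdet]
    have : 0 < x := by linarith
    have : 0 < y := by linarith
    have : 0 < z := by linarith
    positivity
  set Q := (x + 1) * u * ((v + w) + z * (w + u) + y * (u + v)) +
      (y + 1) * v * ((w + u) + x * (u + v) + z * (v + w)) +
      (z + 1) * w * ((u + v) + y * (v + w) + x * (w + u)) with hQ
  have hk : 0 < (y + z) * (x + 1) := by
    apply mul_pos <;> linarith
  have key : α * ((y + z) * (x + 1) * Q) =
      α * ((x + 1) * ((y + z) * u + (y + 1) * v + (z + 1) * w)) ^ 2 +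
        ((α * v + β * w) ^ 2 + (α * γ - β ^ 2) * w ^ 2) := by
    rw [hQ, hα, hβ, hγ]
    ring
  clear_value α β γ Q
  have hx' : 0 < x + 1 := by linarith
  have hyz : 0 < y + z := by linarith
  have hpos : 0 < α * ((x + 1) * ((y + z) * u + (y + 1) * v + (z + 1) * w)) ^ 2 +
        ((α * v + β * w) ^ 2 + (α * γ - β ^ 2) * w ^ 2) := by
    by_cases hw : w = 0
    · subst hw
      by_cases hv : v = 0
      · subst hv
        have hu : u ≠ 0 := by tauto
        simp only [mul_zero, add_zero]
        positivity
      · simp only [mul_zero, add_zero]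
        positivity
    · positivity
  rw [← key] at hpos
  exact pos_of_mul_pos_right (pos_of_mul_pos_right hpos hα0.le) hk.le

/-- Quotient rule; after `sin² + cos² = 1` the coefficients of the two adjacent angles contain the
dual cosine expressions for the other sides. -/
theorem hasDerivAt_sideCosh {a : Fin 3 → ℝ} (ha : IsAngleData a) (d : Fin 3 → ℝ)
    {f : ℝ → Fin 3 → ℝ} {s : ℝ} (hf : ∀ i, HasDerivAt (fun r => f r i) (d i) s) (hfs : f s = a)
    (i : Fin 3) :
    HasDerivAt (fun r => sideCosh (f r) i)
      (-(Real.sin (a i) / (Real.sin (a (i + 1)) * Real.sin (a (i + 2)))) *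
        (d i + sideCosh a (i + 2) * d (i + 1) + sideCosh a (i + 1) * d (i + 2))) s := by
  have a1 : i + 1 + 1 = i + 2 := by revert i; decide
  have a2 : i + 1 + 2 = i := by revert i; decide
  have a3 : i + 2 + 1 = i := by revert i; decide
  have a4 : i + 2 + 2 = i + 1 := by revert i; decide
  subst hfs
  have h0 := (ha.sin_pos i).ne'
  have h1 := (ha.sin_pos (i + 1)).ne'
  have h2 := (ha.sin_pos (i + 2)).ne'
  have hd := ((hf i).cos.add ((hf (i + 1)).cos.mul (hf (i + 2)).cos)).div
    ((hf (i + 1)).sin.mul (hf (i + 2)).sin) (mul_ne_zero h1 h2)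
  refine hd.congr_deriv ?_
  have q1 := Real.sin_sq_add_cos_sq (f s (i + 1))
  have q2 := Real.sin_sq_add_cos_sq (f s (i + 2))
  simp only [sideCosh, a1, a2, a3, a4, Pi.mul_apply, Pi.add_apply]
  generalize Real.sin (f s i) = A at *
  generalize Real.sin (f s (i + 1)) = B at *
  generalize Real.sin (f s (i + 2)) = C at *
  generalize Real.cos (f s i) = A' at *
  generalize Real.cos (f s (i + 1)) = B' at *
  generalize Real.cos (f s (i + 2)) = C' at *
  field_simp
  linear_combination (-d (i + 1) * C * C') * q1 + (-d (i + 2) * B * B') * q2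

/-- Division by `sideCosh a i - 1` comes from differentiating the logarithm. It leaves `sideCosh a i
+ 1` times a factor common to all sides, as `sideForm_pos` requires. -/
theorem IsAngleData.sin_div_eq {a : Fin 3 → ℝ} (ha : IsAngleData a) (i : Fin 3) :
    Real.sin (a i) / (Real.sin (a (i + 1)) * Real.sin (a (i + 2))) / (sideCosh a i - 1) =
      (sideCosh a i + 1) * ((Real.sin (a 0) * Real.sin (a 1) * Real.sin (a 2)) / angleDisc a 0) := by
  have hdisc : angleDisc a i = angleDisc a 0 := by
    fin_cases i <;> simp [angleDisc_eq] <;> ring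
  have hprod : Real.sin (a 0) * Real.sin (a 1) * Real.sin (a 2) =
      Real.sin (a i) * (Real.sin (a (i + 1)) * Real.sin (a (i + 2))) := by
    fin_cases i <;> simp <;> ring
  have hX := ha.one_lt_sideCosh i
  have h1 := (ha.sin_pos (i + 1)).ne'
  have h2 := (ha.sin_pos (i + 2)).ne'
  have h3 : sideCosh a i - 1 ≠ 0 := by linarith
  have hD : angleDisc a i = (sideCosh a i - 1) * (sideCosh a i + 1) *
      (Real.sin (a (i + 1)) * Real.sin (a (i + 2))) ^ 2 := by
    rw [angleDisc, sideCosh]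
    field_simp
    ring
  have h4 : sideCosh a i + 1 ≠ 0 := by linarith
  rw [← hdisc, hprod, hD]
  field_simp

/-- The derivative, along a line of angle data, of the pairing of the direction of the line with
the side lengths. -/
noncomputable def sideRate (a d : Fin 3 → ℝ) : ℝ :=
  -((Real.sin (a 0) * Real.sin (a 1) * Real.sin (a 2)) / angleDisc a 0) *
    ∑ i, (sideCosh a i + 1) * sideCoord d i *
      (d i + sideCosh a (i + 2) * d (i + 1) + sideCosh a (i + 1) * d (i + 2))

theorem hasDerivAt_sum_sideCoord_mul_log {a : Fin 3 → ℝ} (ha : IsAngleData a) (d : Fin 3 → ℝ)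
    {f : ℝ → Fin 3 → ℝ} {s : ℝ} (hf : ∀ i, HasDerivAt (fun r => f r i) (d i) s)
    (hfs : f s = a) :
    HasDerivAt (fun r => ∑ i, sideCoord d i * Real.log (sideCosh (f r) i - 1))
      (sideRate a d) s := by
  have h : ∀ i ∈ Finset.univ, HasDerivAt
      (fun r => sideCoord d i * Real.log (sideCosh (f r) i - 1)) _ s := fun i _ =>
    (((hasDerivAt_sideCosh ha d hf hfs i).sub_const 1).log (by
      rw [hfs]
      linarith [ha.one_lt_sideCosh i])).const_mul (sideCoord d i)
  refine (HasDerivAt.fun_sum h).congr_deriv ?_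
  rw [sideRate, Finset.mul_sum]
  refine Finset.sum_congr rfl fun i _ => ?_
  rw [hfs, neg_mul, neg_div, mul_neg, mul_div_right_comm, ha.sin_div_eq i]
  ring

theorem sideRate_neg {a : Fin 3 → ℝ} (ha : IsAngleData a) {d : Fin 3 → ℝ} (hd : d ≠ 0) :
    sideRate a d < 0 := by
  have hk : 0 < (Real.sin (a 0) * Real.sin (a 1) * Real.sin (a 2)) / angleDisc a 0 :=
    div_pos (mul_pos (mul_pos (ha.sin_pos 0) (ha.sin_pos 1)) (ha.sin_pos 2)) (ha.angleDisc_pos 0)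
  have h0 : sideCoord d 1 + sideCoord d 2 = d 0 := sideCoord_add_sideCoord d 0
  have h1 : sideCoord d 2 + sideCoord d 0 = d 1 := sideCoord_add_sideCoord d 1
  have h2 : sideCoord d 0 + sideCoord d 1 = d 2 := sideCoord_add_sideCoord d 2
  have hne : sideCoord d 0 ≠ 0 ∨ sideCoord d 1 ≠ 0 ∨ sideCoord d 2 ≠ 0 := by
    by_contra! h
    apply hd
    ext i
    fin_cases i
    · simp [← h0, h.2.1, h.2.2]
    · simp [← h1, h.1, h.2.2]
    · simp [← h2, h.1, h.2.1]
  have := mul_pos hk (sideForm_pos (ha.one_lt_sideCosh 0) (ha.one_lt_sideCosh 1)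
    (ha.one_lt_sideCosh 2) ha.gram_pos hne)
  rw [h0, h1, h2] at this
  rw [sideRate, Fin.sum_univ_three]
  change -_ * ((sideCosh a 0 + 1) * sideCoord d 0 *
      (d 0 + sideCosh a 2 * d 1 + sideCosh a 1 * d 2) + (sideCosh a 1 + 1) * sideCoord d 1 *
      (d 1 + sideCosh a 0 * d 2 + sideCosh a 2 * d 0) + (sideCosh a 2 + 1) * sideCoord d 2 *
      (d 2 + sideCosh a 1 * d 0 + sideCosh a 0 * d 1)) < 0
  linarith

theorem sideRate_zero (a : Fin 3 → ℝ) : sideRate a 0 = 0 := by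
  simp [sideRate]

/-- The starting point may be degenerate, hence `0 < s`; this serves the segments issuing from
boundary points. -/
theorem IsAngleData.segment {a b : Fin 3 → ℝ} (ha : (∀ i, 0 ≤ a i) ∧ ∑ i, a i ≤ Real.pi)
    (hb : IsAngleData b) {s : ℝ} (hs : 0 < s) (hs1 : s ≤ 1) : IsAngleData (a + s • (b - a)) := by
  constructor
  · intro i
    have := mul_pos hs (hb.1 i)
    have := mul_nonneg (sub_nonneg.mpr hs1) (ha.1 i)
    simp only [Pi.add_apply, Pi.smul_apply, Pi.sub_apply, smul_eq_mul]
    linarith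
  · simp only [Pi.add_apply, Pi.smul_apply, Pi.sub_apply, smul_eq_mul, Finset.sum_add_distrib,
      ← Finset.mul_sum, Finset.sum_sub_distrib]
    have := mul_lt_mul_of_pos_left hb.2 hs
    have := mul_le_mul_of_nonneg_left ha.2 (sub_nonneg.mpr hs1)
    linarith

theorem IsAngleData.weak {a : Fin 3 → ℝ} (ha : IsAngleData a) :
    (∀ i, 0 ≤ a i) ∧ ∑ i, a i ≤ Real.pi :=
  ⟨fun i => (ha.1 i).le, ha.2.le⟩

theorem hasDerivAt_line (a d : Fin 3 → ℝ) (s : ℝ) (i : Fin 3) :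
    HasDerivAt (fun r : ℝ => (a + r • d) i) (d i) s := by
  simpa using ((hasDerivAt_id s).mul_const (d i)).const_add (a i)

/-- Conformally equivalent uniform angle systems coincide. -/
theorem TriangularDecomposition.eq_of_isUniform {F M : Type*} [TopologicalSpace M] [Fintype F]
    [ChartedSpace (EuclideanHalfSpace 2) M] (T : TriangularDecomposition F M)
    {u u' : F → Fin 3 → ℝ} (hu : T.IsUniform u) (hu' : T.IsUniform u')
    (h : T.ConformallyEquivalent u' u) : u = u' := by
  rw [isUniform_iff] at hu hu'
  by_contra hne
  set d := u' - u with hd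
  have hline : ∀ s ∈ Set.Icc (0 : ℝ) 1, ∀ t, IsAngleData (u t + s • d t) := by
    intro s hs t
    rcases hs.1.eq_or_lt with h0 | h0
    · simpa [← h0] using isAngleData hu.1 t
    · exact IsAngleData.segment (isAngleData hu.1 t).weak (isAngleData hu'.1 t) h0 hs.2
  set G : ℝ → ℝ := fun s =>
    ∑ t, ∑ i, sideCoord (d t) i * Real.log (sideCosh (u t + s • d t) i - 1) with hG
  have hderiv : ∀ s ∈ Set.Icc (0 : ℝ) 1,
      HasDerivAt G (∑ t, sideRate (u t + s • d t) (d t)) s := fun s hs =>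
    HasDerivAt.fun_sum fun t _ =>
      hasDerivAt_sum_sideCoord_mul_log (hline s hs t) (d t) (hasDerivAt_line (u t) (d t) s) rfl
  have hneg : ∀ s ∈ Set.Icc (0 : ℝ) 1, ∑ t, sideRate (u t + s • d t) (d t) < 0 := by
    intro s hs
    obtain ⟨t, ht⟩ : ∃ t, d t ≠ 0 := by
      by_contra! h0
      exact hne (sub_eq_zero.mp (show u' - u = 0 from funext h0)).symm
    refine Finset.sum_neg' (fun t _ => ?_) ⟨t, Finset.mem_univ t, sideRate_neg (hline s hs t) ht⟩
    by_cases h0 : d t = 0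
    · rw [h0, sideRate_zero]
    · exact (sideRate_neg (hline s hs t) h0).le
  have hanti : StrictAntiOn G (Set.Icc 0 1) := by
    refine strictAntiOn_of_deriv_neg (convex_Icc 0 1)
      (fun s hs => (hderiv s hs).continuousAt.continuousWithinAt) fun s hs => ?_
    have hs' := interior_subset hs
    rw [(hderiv s hs').deriv]
    exact hneg s hs'
  -- At either end the lengths match along edges, so the pairing annihilates the conformal direction
  -- `d`.
  have h0 : G 0 = 0 := by
    simp only [hG, zero_smul, add_zero]
    exact T.sum_sideCoord_mul_eq_zero (c := fun t i => Real.log (sideCosh (u t) i - 1))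
      (fun t i t' i' he => by simp only [hu.2 t i t' i' he]) h
  have h1 : G 1 = 0 := by
    simp only [hG, one_smul, hd, Pi.sub_apply, add_sub_cancel]
    exact T.sum_sideCoord_mul_eq_zero (c := fun t i => Real.log (sideCosh (u' t) i - 1))
      (fun t i t' i' he => by simp only [hu'.2 t i t' i' he]) h
  have := hanti (by simp) (by simp) zero_lt_one
  linarith

/-! ### The volume function -/

/-- The Lobachevsky function, up to a linear term. -/
noncomputable def lobachevsky (θ : ℝ) : ℝ := -∫ t in (0 : ℝ)..θ, Real.log (Real.sin t)

theorem continuous_lobachevsky : Continuous lobachevsky :=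
  (intervalIntegral.continuous_primitive (fun _ _ => intervalIntegrable_log_sin) 0).neg

/-- No sign condition is needed, since `Real.log` is the logarithm of the absolute value. -/
theorem hasDerivAt_lobachevsky {θ : ℝ} (h : Real.sin θ ≠ 0) :
    HasDerivAt lobachevsky (-Real.log (Real.sin θ)) θ := by
  refine (intervalIntegral.integral_hasDerivAt_right
    (f := fun t => Real.log (Real.sin t)) intervalIntegrable_log_sin ?_ ?_).neg
  · exact (Real.measurable_log.comp Real.measurable_sin).stronglyMeasurable.stronglyMeasurableAtFilter
  · exact Real.continuous_sin.continuousAt.log h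

/-- The volume (up to normalization) of the ideal hyperbolic prism over the triangle with
angles `a`. -/
noncomputable def prismVolume (a : Fin 3 → ℝ) : ℝ :=
  ∑ i, (lobachevsky (a i) + lobachevsky (Real.pi / 2 - sideCoord a i)) +
    lobachevsky (Real.pi / 2 - (∑ i, a i) / 2)

/-- The derivative of `prismVolume` at `a` in the direction `d`. -/
noncomputable def prismRate (a d : Fin 3 → ℝ) : ℝ :=
  ∑ i, (-d i * Real.log (Real.sin (a i)) +
      -(-sideCoord d i) * Real.log (Real.sin (Real.pi / 2 - sideCoord a i))) +
    -(-((∑ i, d i) / 2)) * Real.log (Real.sin (Real.pi / 2 - (∑ i, a i) / 2))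

theorem continuous_prismVolume : Continuous prismVolume := by
  unfold prismVolume sideCoord
  have := continuous_lobachevsky
  fun_prop

theorem sideCoord_eq (d : Fin 3 → ℝ) (i : Fin 3) : sideCoord d i = (∑ j, d j) / 2 - d i := by
  rw [IsAngleData.sum_cyclic d i, sideCoord]
  ring

namespace IsAngleData

variable {a : Fin 3 → ℝ}

theorem sin_sideCoord_pos (ha : IsAngleData a) (i : Fin 3) :
    0 < Real.sin (Real.pi / 2 - sideCoord a i) := by
  have h := ha.2
  have h0 := ha.1 i
  have h1 := ha.1 (i + 1)
  have h2 := ha.1 (i + 2)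
  rw [sum_cyclic a i] at h
  apply Real.sin_pos_of_pos_of_lt_pi <;> rw [sideCoord] <;> linarith

theorem sin_sum_pos (ha : IsAngleData a) :
    0 < Real.sin (Real.pi / 2 - (∑ i, a i) / 2) := by
  have h := ha.2
  have h0 : 0 ≤ ∑ i, a i := Finset.sum_nonneg fun i _ => (ha.1 i).le
  apply Real.sin_pos_of_pos_of_lt_pi <;> linarith [Real.pi_pos]

theorem hasDerivAt_prismVolume {a b d : Fin 3 → ℝ} {s : ℝ} (h : IsAngleData (b + s • d))
    (ha : b + s • d = a) :
    HasDerivAt (fun r : ℝ => prismVolume (b + r • d)) (prismRate a d) s := by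
  subst ha
  have h1 := hasDerivAt_line b d s
  have h2 : ∀ i, HasDerivAt (fun r : ℝ => Real.pi / 2 - sideCoord (b + r • d) i)
      (-sideCoord d i) s := fun i =>
    ((((h1 (i + 1)).add (h1 (i + 2))).sub (h1 i)).div_const 2).const_sub (Real.pi / 2)
  have h3 : HasDerivAt (fun r : ℝ => Real.pi / 2 - (∑ i, (b + r • d) i) / 2)
      (-((∑ i, d i) / 2)) s :=
    ((HasDerivAt.fun_sum fun i _ => h1 i).div_const 2).const_sub (Real.pi / 2)
  have e1 := fun i => (hasDerivAt_lobachevsky (h.sin_pos i).ne').comp s (h1 i)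
  have e2 := fun i => (hasDerivAt_lobachevsky (h.sin_sideCoord_pos i).ne').comp s (h2 i)
  have e3 := (hasDerivAt_lobachevsky h.sin_sum_pos.ne').comp s h3
  refine ((HasDerivAt.fun_sum fun i _ => (e1 i).add (e2 i)).add e3).congr_deriv ?_
  rw [prismRate]
  congr 1
  · exact Finset.sum_congr rfl fun i _ => by ring
  · ring

/-- The sum-to-product formula factors `sinh² (l i / 2)` into the sines that occur in the derivative
of `prismVolume`. -/
theorem sideCosh_sub_one (ha : IsAngleData a) (i : Fin 3) :
    (sideCosh a i - 1) / 2 =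
      Real.sin (Real.pi / 2 - (∑ j, a j) / 2) * Real.sin (Real.pi / 2 - sideCoord a i) /
        (Real.sin (a (i + 1)) * Real.sin (a (i + 2))) := by
  have h1 := (ha.sin_pos (i + 1)).ne'
  have h2 := (ha.sin_pos (i + 2)).ne'
  have h3 : Real.cos (a i) + Real.cos (a (i + 1) + a (i + 2)) =
      2 * (Real.cos ((∑ j, a j) / 2) * Real.cos (sideCoord a i)) := by
    rw [add_comm, Real.cos_add_cos, mul_assoc]
    congr 3
    · rw [sum_cyclic a i]
      ring_nf
  rw [Real.cos_add] at h3
  rw [Real.sin_pi_div_two_sub, Real.sin_pi_div_two_sub, sideCosh]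
  field_simp
  linarith

/-- In side coordinates the gradient of the volume is `log (sinh² (l i / 2))`, a function of the
length alone; this is why critical points are uniform. -/
theorem prismRate_eq (ha : IsAngleData a) (d : Fin 3 → ℝ) :
    prismRate a d = ∑ i, sideCoord d i * Real.log ((sideCosh a i - 1) / 2) := by
  have h : ∀ i, Real.log ((sideCosh a i - 1) / 2) =
      Real.log (Real.sin (Real.pi / 2 - (∑ j, a j) / 2)) +
        Real.log (Real.sin (Real.pi / 2 - sideCoord a i)) -
        (Real.log (Real.sin (a (i + 1))) + Real.log (Real.sin (a (i + 2)))) := fun i => by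
    have h1 := (ha.sin_pos (i + 1)).ne'
    have h2 := (ha.sin_pos (i + 2)).ne'
    have h3 := (ha.sin_sideCoord_pos i).ne'
    rw [ha.sideCosh_sub_one, Real.log_div (mul_ne_zero ha.sin_sum_pos.ne' h3)
      (mul_ne_zero h1 h2), Real.log_mul ha.sin_sum_pos.ne' h3, Real.log_mul h1 h2]
  simp_rw [h, prismRate]
  simp only [Fin.sum_univ_three]
  have w0 : sideCoord d 1 + sideCoord d 2 = d 0 := sideCoord_add_sideCoord d 0
  have w1 : sideCoord d 2 + sideCoord d 0 = d 1 := sideCoord_add_sideCoord d 1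
  have w2 : sideCoord d 0 + sideCoord d 1 = d 2 := sideCoord_add_sideCoord d 2
  rw [← w0, ← w1, ← w2]
  simp only [show (0 : Fin 3) + 1 = 1 from rfl, show (0 : Fin 3) + 2 = 2 from rfl,
    show (1 : Fin 3) + 1 = 2 from rfl, show (1 : Fin 3) + 2 = 0 from rfl,
    show (2 : Fin 3) + 1 = 0 from rfl, show (2 : Fin 3) + 2 = 1 from rfl]
  ring

end IsAngleData

/-! ### The behaviour of the volume at the boundary -/

-- At a zero of the sine, `sin (θ + s κ)` is asymptotic to `s κ cos θ`, so its logarithm is `log s`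
-- plus a convergent term if `κ ≠ 0`; away from zeros there is no singularity.
open Filter Topology in
theorem exists_tendsto_log_sin (θ κ : ℝ) :
    ∃ c, Tendsto (fun s : ℝ => -κ * Real.log (Real.sin (θ + s * κ)) +
      (if Real.sin θ = 0 then κ else 0) * Real.log s) (𝓝[>] 0) (𝓝 c) := by
  have hd : HasDerivAt (fun s : ℝ => Real.sin (θ + s * κ)) (Real.cos θ * κ) 0 := by
    have := (((hasDerivAt_id (0 : ℝ)).mul_const κ).const_add θ).sin
    simpa using this
  split_ifs with h
  · by_cases hκ : κ = 0
    · exact ⟨0, by simp [hκ]⟩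
    have hc : Real.cos θ * κ ≠ 0 := by
      refine mul_ne_zero (fun hc => ?_) hκ
      have := Real.sin_sq_add_cos_sq θ
      rw [h, hc] at this
      norm_num at this
    have ht := hd.tendsto_slope_zero_right
    simp only [zero_add, zero_mul, add_zero, h, sub_zero, smul_eq_mul] at ht
    refine ⟨-κ * Real.log (Real.cos θ * κ), ((ht.log hc).const_mul (-κ)).congr' ?_⟩
    filter_upwards [ht.eventually_ne hc, self_mem_nhdsWithin] with s hs hs0
    have hs0' : s ≠ 0 := ne_of_gt hs0
    rw [Real.log_mul (inv_ne_zero hs0') (right_ne_zero_of_mul hs), Real.log_inv]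
    ring
  · refine ⟨-κ * Real.log (Real.sin (θ + 0 * κ)) + 0, ?_⟩
    simp only [zero_mul]
    refine Tendsto.add_const 0 (Tendsto.const_mul _ ?_)
    have hc := hd.continuousAt.tendsto.mono_left (nhdsWithin_le_nhds (s := Set.Ioi 0))
    simp only [zero_mul, add_zero] at hc ⊢
    exact hc.log h

/-- The coefficient of `-log s` in the derivative of `s ↦ prismVolume (a + s • d)` as `s → 0`. -/
noncomputable def prismOrder (a d : Fin 3 → ℝ) : ℝ :=
  ∑ i, ((if Real.sin (a i) = 0 then d i else 0) +
      (if Real.sin (Real.pi / 2 - sideCoord a i) = 0 then -sideCoord d i else 0)) +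
    (if Real.sin (Real.pi / 2 - (∑ i, a i) / 2) = 0 then -((∑ i, d i) / 2) else 0)

open Filter Topology in
theorem exists_tendsto_prismRate (a d : Fin 3 → ℝ) :
    ∃ c, Tendsto (fun s : ℝ => prismRate (a + s • d) d + prismOrder a d * Real.log s)
      (𝓝[>] 0) (𝓝 c) := by
  choose c₁ h₁ using fun i => exists_tendsto_log_sin (a i) (d i)
  choose c₂ h₂ using fun i => exists_tendsto_log_sin (Real.pi / 2 - sideCoord a i) (-sideCoord d i)
  obtain ⟨c₃, h₃⟩ := exists_tendsto_log_sin (Real.pi / 2 - (∑ i, a i) / 2) (-((∑ i, d i) / 2))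
  refine ⟨_, ((tendsto_finsetSum Finset.univ fun i _ => (h₁ i).add (h₂ i)).add h₃).congr
    fun s => ?_⟩
  have e1 : ∀ i, (a + s • d) i = a i + s * d i := fun i => rfl
  have e2 : ∀ i, Real.pi / 2 - sideCoord (a + s • d) i =
      Real.pi / 2 - sideCoord a i + s * -sideCoord d i := fun i => by
    rw [sideCoord_add, sideCoord_smul]
    ring
  have e3 : Real.pi / 2 - (∑ i, (a + s • d) i) / 2 =
      Real.pi / 2 - (∑ i, a i) / 2 + s * -((∑ i, d i) / 2) := by
    simp only [e1, Finset.sum_add_distrib, ← Finset.mul_sum]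
    ring
  rw [prismRate, prismOrder, e3]
  simp only [e2, e1, Fin.sum_univ_three]
  ring

/-- All seven sines vanish, and with `S = ∑ i, d i` the contributions `S`, `-S / 2` and `-S / 2`
cancel. This is why `{0, 0, π}` is not legal. -/
theorem prismOrder_of_isDegenerate {a : Fin 3 → ℝ}
    (ha : ∃ i, a i = Real.pi ∧ ∀ j, j ≠ i → a j = 0) (d : Fin 3 → ℝ) : prismOrder a d = 0 := by
  obtain ⟨i, hi, hj⟩ := ha
  have hs : ∑ j, a j = Real.pi := by
    rw [Finset.sum_eq_single i (fun j _ h => hj j h) (by simp), hi]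
  have h1 : ∀ j, Real.sin (a j) = 0 := fun j => by
    by_cases h : j = i
    · rw [h, hi, Real.sin_pi]
    · rw [hj j h, Real.sin_zero]
  have h2 : ∀ j, Real.sin (Real.pi / 2 - sideCoord a j) = 0 := fun j => by
    rw [sideCoord_eq, hs, sub_sub_cancel, h1]
  rw [prismOrder, hs, sub_self, Real.sin_zero, if_pos rfl]
  simp only [h1, h2, if_true]
  simp only [Fin.sum_univ_three, sideCoord_eq]
  ring

/-- Since `π / 2 - sideCoord a i` is the sum of `(π - ∑ j, a j) / 2` and `a i`, both nonnegative,
its sine vanishes only when both are zero. -/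
theorem prismOrder_eq {a : Fin 3 → ℝ} (ha : (∀ i, 0 ≤ a i) ∧ ∑ i, a i ≤ Real.pi)
    (hlt : ∀ i, a i < Real.pi) (d : Fin 3 → ℝ) :
    prismOrder a d = if ∑ i, a i = Real.pi then
        ∑ i, (if a i = 0 then d i - sideCoord d i else 0) - (∑ i, d i) / 2
      else ∑ i, (if a i = 0 then d i else 0) := by
  have h1 : ∀ i, Real.sin (a i) = 0 ↔ a i = 0 := fun i =>
    Real.sin_eq_zero_iff_of_lt_of_lt (by linarith [ha.1 i, Real.pi_pos]) (hlt i)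
  have h0 : 0 ≤ ∑ i, a i := Finset.sum_nonneg fun i _ => ha.1 i
  have h2 : ∀ i, Real.sin (Real.pi / 2 - sideCoord a i) = 0 ↔
      ∑ i, a i = Real.pi ∧ a i = 0 := fun i => by
    have := ha.1 i
    have hle := ha.2
    have := hlt i
    have h3 : a i ≤ ∑ i, a i := Finset.single_le_sum (fun j _ => ha.1 j) (Finset.mem_univ i)
    rw [sideCoord_eq, Real.sin_eq_zero_iff_of_lt_of_lt (by linarith) (by linarith)]
    constructor
    · intro h
      constructor <;> linarith
    · rintro ⟨h, h'⟩
      linarith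
  have h3 : Real.sin (Real.pi / 2 - (∑ i, a i) / 2) = 0 ↔ ∑ i, a i = Real.pi := by
    have hle := ha.2
    rw [Real.sin_eq_zero_iff_of_lt_of_lt (by linarith [Real.pi_pos]) (by linarith [Real.pi_pos])]
    constructor <;> intro <;> linarith
  rw [prismOrder]
  simp only [h1, h2, h3]
  by_cases hs : ∑ i, a i = Real.pi
  · simp only [hs, true_and, if_true]
    rw [sub_eq_add_neg]
    congr 1
    refine Finset.sum_congr rfl fun i _ => ?_
    split_ifs <;> ring
  · simp only [hs, false_and, if_false, add_zero]

theorem exists_eq_pi_or_lt_pi {a : Fin 3 → ℝ} (ha : (∀ i, 0 ≤ a i) ∧ ∑ i, a i ≤ Real.pi) :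
    (∃ i, a i = Real.pi ∧ ∀ j, j ≠ i → a j = 0) ∨ ∀ i, a i < Real.pi := by
  by_cases h : ∀ i, a i < Real.pi
  · exact Or.inr h
  · push Not at h
    obtain ⟨i, hi⟩ := h
    have hs := ha.2
    rw [← Finset.add_sum_erase _ _ (Finset.mem_univ i)] at hs
    have h0 : 0 ≤ ∑ j ∈ Finset.univ.erase i, a j := Finset.sum_nonneg fun j _ => ha.1 j
    refine Or.inl ⟨i, by linarith, fun j hj => ?_⟩
    exact (Finset.sum_eq_zero_iff_of_nonneg fun j _ => ha.1 j).mp (by linarith) j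
      (by simp [hj])

/-- Towards `b` zero angles grow and an angle sum of `π` decreases. In the flat case `d i -
sideCoord d i = 2 * d i - (∑ j, d j) / 2`, so all terms have the right sign. -/
theorem prismOrder_nonneg {a b : Fin 3 → ℝ} (ha : (∀ i, 0 ≤ a i) ∧ ∑ i, a i ≤ Real.pi)
    (hb : IsAngleData b) : 0 ≤ prismOrder a (b - a) := by
  rcases exists_eq_pi_or_lt_pi ha with h | h
  · rw [prismOrder_of_isDegenerate h]
  have hd : ∀ i, a i = 0 → 0 < (b - a) i := fun i hi => by simpa [hi] using hb.1 i
  rw [prismOrder_eq ha h]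
  split_ifs with hs
  · have hS : ∑ i, (b - a) i < 0 := by
      simp only [Pi.sub_apply, Finset.sum_sub_distrib, hs]
      linarith [hb.2]
    have : 0 ≤ ∑ i, (if a i = 0 then (b - a) i - sideCoord (b - a) i else 0) := by
      refine Finset.sum_nonneg fun i _ => ?_
      split_ifs with hi
      · rw [sideCoord_eq]
        linarith [hd i hi]
      · exact le_rfl
    linarith
  · refine Finset.sum_nonneg fun i _ => ?_
    split_ifs with hi
    · exact (hd i hi).le
    · exact le_rfl

theorem prismOrder_pos {F : Type*} {x : F → Fin 3 → ℝ} {t : F}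
    (ha : (∀ i, 0 ≤ x t i) ∧ ∑ i, x t i ≤ Real.pi) {b : Fin 3 → ℝ}
    (hb : IsAngleData b) (hl : IsLegal x t) : 0 < prismOrder (x t) (b - x t) := by
  rcases exists_eq_pi_or_lt_pi ha with h | h
  · exact absurd h hl.1
  have hd : ∀ i, x t i = 0 → 0 < (b - x t) i := fun i hi => by simpa [hi] using hb.1 i
  rw [prismOrder_eq ha h]
  split_ifs with hs
  · have hS : ∑ i, (b - x t) i < 0 := by
      simp only [Pi.sub_apply, Finset.sum_sub_distrib, hs]
      linarith [hb.2]
    have : 0 ≤ ∑ i, (if x t i = 0 then (b - x t) i - sideCoord (b - x t) i else 0) := by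
      refine Finset.sum_nonneg fun i _ => ?_
      split_ifs with hi
      · rw [sideCoord_eq]
        linarith [hd i hi]
      · exact le_rfl
    linarith
  · obtain ⟨i, hi⟩ := hl.2.resolve_left fun h0 => hs (sub_eq_zero.mp h0)
    refine Finset.sum_pos' (fun j _ => ?_) ⟨i, Finset.mem_univ i, by simpa [hi] using hd i hi⟩
    split_ifs with hj
    · exact (hd j hj).le
    · exact le_rfl

/-! ### Maximal volume -/

namespace TriangularDecomposition

variable {F M : Type*} [TopologicalSpace M] [Fintype F] [ChartedSpace (EuclideanHalfSpace 2) M]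
  (T : TriangularDecomposition F M)

theorem mem_angleSystems_iff (x : F → Fin 3 → ℝ) :
    x ∈ T.angleSystems ↔ x ∈ T.flat ∧ ∀ t, IsAngleData (x t) :=
  ⟨fun h => ⟨h.1, isAngleData h⟩, fun h => ⟨h.1, fun t =>
    ⟨sub_neg.mpr (h.2 t).2, fun i => ⟨(h.2 t).1 i, (h.2 t).lt_pi i⟩⟩⟩⟩

theorem closure_angleSystems_subset : closure T.angleSystems ⊆
    {x | ∀ t, (∀ i, 0 ≤ x t i) ∧ ∑ i, x t i ≤ Real.pi} := by
  refine closure_minimal (fun x hx t => (isAngleData hx t).weak) ?_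
  simp only [Set.ofPred_forall, Set.ofPred_and]
  refine isClosed_iInter fun t => IsClosed.inter (isClosed_iInter fun i => ?_) ?_
  · exact isClosed_le (by fun_prop) (by fun_prop)
  · exact isClosed_le (by fun_prop) (by fun_prop)

theorem isCompact_closure_angleSystems : IsCompact (closure T.angleSystems) := by
  have hc : IsCompact (Set.univ.pi fun _ : F => Set.univ.pi fun _ : Fin 3 => Set.Icc 0 Real.pi) :=
    isCompact_univ_pi fun _ => isCompact_univ_pi fun _ => isCompact_Icc
  refine hc.of_isClosed_subset isClosed_closure fun x hx t _ i _ => ?_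
  have h := T.closure_angleSystems_subset hx t
  exact ⟨h.1 i, (Finset.single_le_sum (fun j _ => h.1 j) (Finset.mem_univ i)).trans h.2⟩

theorem isClosed_conformalClass {F M : Type*} [TopologicalSpace M] [Fintype F]
    (T : TriangularDecomposition F M) (x : F → Fin 3 → ℝ) :
    IsClosed {y | T.ConformallyEquivalent y x} :=
  (Submodule.closed_of_finiteDimensional T.conformalDeformations).preimage
    (continuous_id.sub continuous_const)

/-- The volume cannot be maximal in a conformal class at a boundary point with a legal triangle. -/
theorem exists_prismVolume_lt {x y : F → Fin 3 → ℝ} (hx : x ∈ T.angleSystems)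
    (hy : y ∈ closure T.angleSystems) (hxy : T.ConformallyEquivalent y x) {t₀ : F}
    (ht₀ : IsLegal y t₀) : ∃ z ∈ T.angleSystems, T.ConformallyEquivalent z x ∧
      ∑ t, prismVolume (y t) < ∑ t, prismVolume (z t) := by
  have hw := T.closure_angleSystems_subset hy
  have hdata : ∀ s : ℝ, 0 < s → s ≤ 1 → ∀ t, IsAngleData (y t + s • (x t - y t)) :=
    fun s hs hs1 t => IsAngleData.segment (hw t) (isAngleData hx t) hs hs1
  set φ : ℝ → ℝ := fun s => ∑ t, prismVolume (y t + s • (x t - y t)) with hφ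
  have hderiv : ∀ s : ℝ, 0 < s → s ≤ 1 →
      HasDerivAt φ (∑ t, prismRate (y t + s • (x t - y t)) (x t - y t)) s := fun s hs hs1 =>
    HasDerivAt.fun_sum fun t _ => (hdata s hs hs1 t).hasDerivAt_prismVolume rfl
  have hκ : 0 < ∑ t, prismOrder (y t) (x t - y t) :=
    Finset.sum_pos' (fun t _ => prismOrder_nonneg (hw t) (isAngleData hx t))
      ⟨t₀, Finset.mem_univ t₀, prismOrder_pos (hw t₀) (isAngleData hx t₀) ht₀⟩
  choose c hc using fun t => exists_tendsto_prismRate (y t) (x t - y t)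
  -- The derivative is `-κ log s` plus a convergent term, with `κ > 0` by the legal triangle `t₀`.
  have htop : Filter.Tendsto (fun s : ℝ => ∑ t, prismRate (y t + s • (x t - y t)) (x t - y t))
      (nhdsWithin 0 (Set.Ioi 0)) Filter.atTop := by
    have h1 := tendsto_finsetSum Finset.univ fun t _ => hc t
    have h2 : Filter.Tendsto (fun s : ℝ => -((∑ t, prismOrder (y t) (x t - y t)) * Real.log s))
        (nhdsWithin 0 (Set.Ioi 0)) Filter.atTop :=
      Filter.tendsto_neg_atBot_atTop.comp
        (Real.tendsto_log_nhdsGT_zero.const_mul_atBot hκ)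
    refine (h1.add_atTop h2).congr fun s => ?_
    rw [Finset.sum_add_distrib, ← Finset.sum_mul]
    ring
  have hev := htop.eventually (Filter.eventually_gt_atTop 0)
  obtain ⟨ε, hε, hpos⟩ := (mem_nhdsGT_iff_exists_Ioc_subset).mp hev
  have hε0 : (0 : ℝ) < ε := hε
  set δ := min ε 1 with hδ
  have hδ0 : 0 < δ := lt_min hε0 zero_lt_one
  have hδ1 : δ ≤ 1 := min_le_right _ _
  have hcont : Continuous φ := by
    have := continuous_prismVolume
    fun_prop
  have hmono : StrictMonoOn φ (Set.Icc 0 δ) := by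
    refine strictMonoOn_of_deriv_pos (convex_Icc 0 δ) hcont.continuousOn fun s hs => ?_
    rw [interior_Icc] at hs
    rw [(hderiv s hs.1 (hs.2.le.trans hδ1)).deriv]
    exact hpos ⟨hs.1, hs.2.le.trans (min_le_left _ _)⟩
  have hlt := hmono ⟨le_rfl, hδ0.le⟩ ⟨hδ0.le, le_rfl⟩ hδ0
  have hconf : T.ConformallyEquivalent (y + δ • (x - y)) x := by
    have h1 : y + δ • (x - y) - x = (1 - δ) • (y - x) := by
      ext t i
      simp only [Pi.add_apply, Pi.smul_apply, Pi.sub_apply, smul_eq_mul]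
      ring
    rw [ConformallyEquivalent, h1]
    exact Submodule.smul_mem _ _ hxy
  refine ⟨y + δ • (x - y), ?_, hconf, ?_⟩
  · rw [mem_angleSystems_iff]
    exact ⟨T.mem_flat_of_conformallyEquivalent hx.1 hconf, hdata δ hδ0 hδ1⟩
  · simpa [hφ] using hlt

/-- An angle system of maximal volume in its conformal class is uniform. -/
theorem isUniform_of_isMax {x y : F → Fin 3 → ℝ} (hy : y ∈ T.angleSystems)
    (hxy : T.ConformallyEquivalent y x)
    (hmax : ∀ z ∈ T.angleSystems, T.ConformallyEquivalent z x →
      ∑ t, prismVolume (z t) ≤ ∑ t, prismVolume (y t)) : T.IsUniform y := by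
  rw [isUniform_iff]
  refine ⟨hy, fun t i t' i' he => ?_⟩
  have hdata := isAngleData hy
  have hzero : ∀ d ∈ T.conformalDeformations,
      ∑ t, ∑ i, sideCoord (d t) i * Real.log ((sideCosh (y t) i - 1) / 2) = 0 := by
    intro d hd
    have hderiv : HasDerivAt (fun s : ℝ => ∑ t, prismVolume (y t + s • d t))
        (∑ t, prismRate (y t) (d t)) 0 :=
      HasDerivAt.fun_sum fun t _ => IsAngleData.hasDerivAt_prismVolume
        (by simpa using hdata t) (by simp)
    have hconf : ∀ s : ℝ, T.ConformallyEquivalent (y + s • d) x := fun s => by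
      have h1 : y + s • d - x = (y - x) + s • d := by abel
      rw [ConformallyEquivalent, h1]
      exact Submodule.add_mem _ hxy (Submodule.smul_mem _ _ hd)
    -- The angle inequalities are open, so small moves in both directions are allowed and the
    -- derivative must vanish.
    have hnear : ∀ᶠ s : ℝ in nhds 0, ∀ t, IsAngleData (y t + s • d t) := by
      refine Filter.eventually_all.mpr fun t =>
        (Filter.eventually_all.mpr fun i => ?_).and ?_
      · have hc : Continuous fun s : ℝ => (y t + s • d t) i := by fun_prop
        exact hc.continuousAt.eventually (lt_mem_nhds (by simpa using (hdata t).1 i))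
      · have hc : Continuous fun s : ℝ => ∑ i, (y t + s • d t) i := by fun_prop
        exact hc.continuousAt.eventually (gt_mem_nhds (by simpa using (hdata t).2))
    have hloc : IsLocalMax (fun s : ℝ => ∑ t, prismVolume (y t + s • d t)) 0 := by
      filter_upwards [hnear] with s hs
      have hflat : y + s • d ∈ T.flat := T.mem_flat_of_conformallyEquivalent hy.1
        (by simpa [ConformallyEquivalent] using Submodule.smul_mem _ s hd)
      simpa using hmax (y + s • d) ((T.mem_angleSystems_iff _).mpr ⟨hflat, hs⟩) (hconf s)
    rw [← hloc.hasDerivAt_eq_zero hderiv]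
    exact Finset.sum_congr rfl fun t _ => ((hdata t).prismRate_eq (d t)).symm
  have h := T.eq_of_sum_sideCoord_mul_eq_zero
    (c := fun t i => Real.log ((sideCosh (y t) i - 1) / 2)) hzero he
  have h1 := (hdata t).one_lt_sideCosh i
  have h2 := (hdata t').one_lt_sideCosh i'
  have := Real.log_injOn_pos (Set.mem_Ioi.mpr (by linarith)) (Set.mem_Ioi.mpr (by linarith)) h
  linarith

theorem exists_isUniform {x : F → Fin 3 → ℝ} (hx : x ∈ T.angleSystems)
    (hB : {y | T.ConformallyEquivalent y x} ∩ T.badSet = ∅) :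
    ∃ u, T.IsUniform u ∧ T.ConformallyEquivalent u x := by
  have hcompact := T.isCompact_closure_angleSystems.inter_right (T.isClosed_conformalClass x)
  have hxx : T.ConformallyEquivalent x x := by simp [ConformallyEquivalent]
  have hcont : Continuous fun y : F → Fin 3 → ℝ => ∑ t, prismVolume (y t) := by
    have := continuous_prismVolume
    fun_prop
  obtain ⟨y, ⟨hy, hyx⟩, hmax⟩ :=
    hcompact.exists_isMaxOn ⟨x, subset_closure hx, hxx⟩ hcont.continuousOn
  have hmax' : ∀ z ∈ T.angleSystems, T.ConformallyEquivalent z x →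
      ∑ t, prismVolume (z t) ≤ ∑ t, prismVolume (y t) := fun z hz hzx =>
    hmax ⟨subset_closure hz, hzx⟩
  refine ⟨y, T.isUniform_of_isMax ?_ hyx hmax', hyx⟩
  by_contra hN
  have hnb : y ∉ T.badSet := fun hb => Set.eq_empty_iff_forall_notMem.mp hB y ⟨hyx, hb⟩
  obtain ⟨t₀, ht₀⟩ : ∃ t, IsLegal y t := by
    by_contra! h
    exact hnb ⟨⟨hy, hN⟩, h⟩
  obtain ⟨z, hz, hzx, hlt⟩ := T.exists_prismVolume_lt hx hy hyx ht₀
  exact (hmax' z hz hzx).not_gt hlt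

end TriangularDecomposition

/-- The triangular decomposition theorem. -/
theorem mainTheorem2
    {M : Type*} [TopologicalSpace M] [T2Space M] [CompactSpace M]
    [ChartedSpace (EuclideanHalfSpace 2) M]
    {M' : Type*} [TopologicalSpace M'] [SimplyConnectedSpace M']
    (p : M' → M) (hp : IsCoveringMap p) (hp_surj : Function.Surjective p)
    {F : Type*} [Fintype F] (T : TriangularDecomposition F M)
    (hT : T.LiftsToTriangulation p) (hχ : T.eulerChar < 0)
    (x : F → Fin 3 → ℝ) (hx : x ∈ T.angleSystems) :
    (∀ u u', T.IsUniform u → T.ConformallyEquivalent u x →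
      T.IsUniform u' → T.ConformallyEquivalent u' x → u = u') ∧
    ({y | T.ConformallyEquivalent y x} ∩ T.badSet = ∅ →
      ∃ u, T.IsUniform u ∧ T.ConformallyEquivalent u x) := by
  refine ⟨fun u u' hu hux hu' hux' => T.eq_of_isUniform hu hu' ?_, T.exists_isUniform hx⟩
  have : u' - u = (u' - x) - (u - x) := by abel
  rw [TriangularDecomposition.ConformallyEquivalent, this]
  exact Submodule.sub_mem _ hux' hux
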